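/- Let $K$ be a field of arbitrary characteristic, let $r\ge 0$ be an integer, and let $\mathfrak{f}_{r,3}$ be the free $3$-step nilpotent Lie algebra over $K$ on $r$ generators, i.e. the quotient of the free Lie algebra $\mathfrak{f}_r$ over $K$ on $r$ generators by the ideal $\gamma_4(\mathfrak{f}_r)$, where $\gamma_1(\mathfrak{f}_r)=\mathfrak{f}_r$ and $\gamma_{i+1}(\mathfrak{f}_r)=[\mathfrak{f}_r,\gamma_i(\mathfrak{f}_r)]$. For a Lie algebra $\mathfrak{g}$ over $K$, let $\mathrm{Inn}(\mathfrak{g})=\{\mathrm{ad}(y) : y\in\mathfrak{g}\}$ be the space of inner derivations, and let $\mathrm{AID}(\mathfrak{g})$ be the space of almost inner derivations, i.e. of all $K$-linear derivations $D$ of $\mathfrak{g}$ such that for every $x\in\mathfrak{g}$ we have $D(x)\in[\mathfrak{g},x]=\{[y,x] : y\in\mathfrak{g}\}$. Then $$\mathrm{AID}(\mathfrak{f}_{r,3})=\mathrm{Inn}(\mathfrak{f}_{r,3}).$$ -/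

import Mathlib

/-- The free `c`-step nilpotent Lie algebra `𝔣_{r,c}` on `r` generators over `K`: the quotient of
the free Lie algebra on `r` generators by the term `γ_{c+1}` of its lower central series.
In Mathlib's indexing `lowerCentralSeries K L L 0 = L = γ_1`, so `γ_{c+1}` has index `c`. -/
abbrev FreeNilpotentLieAlgebra (K : Type*) [Field K] (r c : ℕ) : Type _ :=
  FreeLieAlgebra K (Fin r) ⧸
    LieModule.lowerCentralSeries K (FreeLieAlgebra K (Fin r)) (FreeLieAlgebra K (Fin r)) c

section AlmostInner

variable (K L : Type*) [Field K] [LieRing L] [LieAlgebra K L]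

/-- `AID(L)`: the Lie subalgebra of `Der(L)` of all almost inner derivations, that is, of those
derivations `D` with `D x ∈ [L, x] = {[y, x] | y ∈ L}` for all `x ∈ L`. -/
def almostInnerDerivations : LieSubalgebra K (LieDerivation K L L) where
  carrier := {D | ∀ x : L, ∃ y : L, D x = ⁅y, x⁆}
  zero_mem' := fun _ => ⟨0, by simp⟩
  add_mem' := by
    intro D E hD hE x
    obtain ⟨y, hy⟩ := hD x
    obtain ⟨z, hz⟩ := hE x
    exact ⟨y + z, by simp [hy, hz]⟩
  smul_mem' := by
    intro t D hD x
    obtain ⟨y, hy⟩ := hD x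
    exact ⟨t • y, by simp [hy]⟩
  lie_mem' := by
    intro D E hD hE x
    obtain ⟨y, hy⟩ := hD x
    obtain ⟨z, hz⟩ := hE x
    refine ⟨D z - E y - ⁅y, z⁆, ?_⟩
    rw [LieDerivation.commutator_apply, hy, hz, LieDerivation.apply_lie_eq_add,
      LieDerivation.apply_lie_eq_add, hy, hz]
    simp only [sub_lie, lie_lie]
    abel

/-- `Inn(L)`: the Lie subalgebra of `Der(L)` of all inner derivations `ad y : x ↦ [y, x]`. -/
def innerDerivations : LieSubalgebra K (LieDerivation K L L) :=
  (LieDerivation.ad K L).range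

end AlmostInner

/-!
Let `L` be the free three-step nilpotent Lie algebra on `x₁, …, x_r`, with lower central series
`γ₁ ⊇ γ₂ ⊇ γ₃ ⊇ γ₄ = 0`. An almost inner derivation `D` is determined by its values
`D xᵢ = [yᵢ, xᵢ]`, and all the information needed to compare the `yᵢ` comes from the requirement
that `D (xᵢ + xⱼ)` be a bracket with `xᵢ + xⱼ`. As only coefficients `0` and `1` occur, the argument
works over every field.

In degree two, this requirement says that the coefficient of `xₖ` in `yᵢ` does not depend on
`i ≠ k`. Subtracting an inner derivation gives `D xᵢ = [gᵢ, xᵢ]` with `gᵢ ∈ γ₂`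
(`exists_forall_apply_eq_lie_of_almostInner`). Then `D (xᵢ + xⱼ) = [h, xᵢ + xⱼ]` for some `h ∈ γ₂`,
that is, `[gᵢ - h, xᵢ] + [gⱼ - h, xⱼ] = 0`. In degree three such a relation with `i ≠ j` forces
`gᵢ - h` and `gⱼ - h` to be central (`lie_eq_zero_of_lie_add_lie_eq_zero`). Hence all `gᵢ` agree
modulo the centre, and `D` is inner (`almostInnerDerivations_le_innerDerivations`).

Coefficients are read off through the homomorphism from `L` to the tensor algebra truncated above
degree three. Its injectivity is not needed in full: it suffices that elements of `γ₁` and `γ₂` are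
determined modulo `γ₂` and `γ₃` by their tensors (`sub_sum_coeff₁_mem`, `sub_sum_coeff₂_mem`), which
follows by writing them in terms of the generators.
-/

/-! ### The truncated tensor algebra as a Lie algebra -/

/-- The truncated tensor algebra `T¹ ⊕ T² ⊕ T³` on `Kʳ` (without constants), an element being
given by its coefficients on the words of length one, two and three; it is viewed as a Lie algebra
under the commutator bracket. -/
def TruncatedTensor (K : Type*) (r : ℕ) : Type _ :=
  (Fin r → K) × (Fin r → Fin r → K) × (Fin r → Fin r → Fin r → K)

namespace TruncatedTensor

variable {K : Type*} [Field K] {r : ℕ}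

instance : AddCommGroup (TruncatedTensor K r) :=
  inferInstanceAs (AddCommGroup
    ((Fin r → K) × (Fin r → Fin r → K) × (Fin r → Fin r → Fin r → K)))

instance : Module K (TruncatedTensor K r) :=
  inferInstanceAs (Module K
    ((Fin r → K) × (Fin r → Fin r → K) × (Fin r → Fin r → Fin r → K)))

/-- The coefficients on the words of length one. -/
def coeff₁ : TruncatedTensor K r →ₗ[K] (Fin r → K) :=
  LinearMap.fst K (Fin r → K) ((Fin r → Fin r → K) × (Fin r → Fin r → Fin r → K))

/-- The coefficients on the words of length two. -/
def coeff₂ : TruncatedTensor K r →ₗ[K] (Fin r → Fin r → K) :=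
  LinearMap.fst K (Fin r → Fin r → K) (Fin r → Fin r → Fin r → K) ∘ₗ
    LinearMap.snd K (Fin r → K) ((Fin r → Fin r → K) × (Fin r → Fin r → Fin r → K))

/-- The coefficients on the words of length three. -/
def coeff₃ : TruncatedTensor K r →ₗ[K] (Fin r → Fin r → Fin r → K) :=
  LinearMap.snd K (Fin r → Fin r → K) (Fin r → Fin r → Fin r → K) ∘ₗ
    LinearMap.snd K (Fin r → K) ((Fin r → Fin r → K) × (Fin r → Fin r → Fin r → K))

theorem ext_coeff {u v : TruncatedTensor K r} (h₁ : ∀ p, coeff₁ u p = coeff₁ v p)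
    (h₂ : ∀ p q, coeff₂ u p q = coeff₂ v p q)
    (h₃ : ∀ p q s, coeff₃ u p q s = coeff₃ v p q s) : u = v :=
  Prod.ext (funext h₁) (Prod.ext (funext₂ h₂) (funext fun p => funext₂ (h₃ p)))

instance : Bracket (TruncatedTensor K r) (TruncatedTensor K r) where
  bracket u v :=
    (0, fun p q => coeff₁ u p * coeff₁ v q - coeff₁ v p * coeff₁ u q,
      fun p q s => coeff₁ u p * coeff₂ v q s + coeff₂ u p q * coeff₁ v s -
        (coeff₁ v p * coeff₂ u q s + coeff₂ v p q * coeff₁ u s))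

@[simp] theorem coeff₁_lie (u v : TruncatedTensor K r) (p : Fin r) : coeff₁ ⁅u, v⁆ p = 0 := rfl

@[simp] theorem coeff₂_lie (u v : TruncatedTensor K r) (p q : Fin r) :
    coeff₂ ⁅u, v⁆ p q = coeff₁ u p * coeff₁ v q - coeff₁ v p * coeff₁ u q := rfl

@[simp] theorem coeff₃_lie (u v : TruncatedTensor K r) (p q s : Fin r) :
    coeff₃ ⁅u, v⁆ p q s = coeff₁ u p * coeff₂ v q s + coeff₂ u p q * coeff₁ v s -
      (coeff₁ v p * coeff₂ u q s + coeff₂ v p q * coeff₁ u s) := rfl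

instance : LieRing (TruncatedTensor K r) where
  add_lie u v w := by
    apply ext_coeff <;> intros <;> simp <;> ring
  lie_add u v w := by
    apply ext_coeff <;> intros <;> simp <;> ring
  lie_self u := by
    apply ext_coeff <;> intros <;> simp
  leibniz_lie u v w := by
    apply ext_coeff <;> intros <;> simp
    ring

instance : LieAlgebra K (TruncatedTensor K r) where
  lie_smul t u v := by
    apply ext_coeff <;> intros <;> simp <;> ring

/-- The `i`-th basis vector of `Kʳ`, as an element of degree one. -/
def single (i : Fin r) : TruncatedTensor K r := (Pi.single i 1, 0, 0)

@[simp] theorem coeff₁_single (i p : Fin r) :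
    coeff₁ (single i : TruncatedTensor K r) p = if p = i then 1 else 0 :=
  Pi.single_apply i (1 : K) p

@[simp] theorem coeff₂_single (i p q : Fin r) :
    coeff₂ (single i : TruncatedTensor K r) p q = 0 := rfl

theorem lowerCentralSeries_three_eq_bot :
    LieModule.lowerCentralSeries K (TruncatedTensor K r) (TruncatedTensor K r) 3 = ⊥ := by
  let J₁ : LieIdeal K (TruncatedTensor K r) :=
    { LinearMap.ker (coeff₁ (K := K) (r := r)) with
      lie_mem := fun {u v} _ => funext (coeff₁_lie u v) }
  let J₂ : LieIdeal K (TruncatedTensor K r) :=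
    { LinearMap.ker (coeff₁ (K := K) (r := r)) ⊓ LinearMap.ker (coeff₂ (K := K) (r := r)) with
      lie_mem := fun {u v} hv => ⟨funext (coeff₁_lie u v), funext₂ fun p q => by
        have h : coeff₁ v = 0 := hv.1
        simp [h]⟩ }
  have h₁ : LieModule.lowerCentralSeries K (TruncatedTensor K r) (TruncatedTensor K r) 1 ≤ J₁ := by
    rw [LieModule.lowerCentralSeries_succ, LieSubmodule.lie_le_iff]
    exact fun u _ v _ => funext (coeff₁_lie u v)
  have h₂ : LieModule.lowerCentralSeries K (TruncatedTensor K r) (TruncatedTensor K r) 2 ≤ J₂ := by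
    rw [LieModule.lowerCentralSeries_succ, LieSubmodule.lie_le_iff]
    intro u _ v hv
    have h : coeff₁ v = 0 := h₁ hv
    exact ⟨funext (coeff₁_lie u v), funext₂ fun p q => by simp [h]⟩
  rw [LieModule.lowerCentralSeries_succ, eq_bot_iff, LieSubmodule.lie_le_iff]
  intro u _ v hv
  have h : coeff₁ v = 0 := (h₂ hv).1
  have h' : coeff₂ v = 0 := (h₂ hv).2
  rw [LieSubmodule.mem_bot]
  apply ext_coeff <;> intros <;> simp [h, h']

end TruncatedTensor

/-! ### Three-step nilpotent Lie algebras detected by the truncated tensor algebra -/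

section Detection

open LieModule TruncatedTensor

variable {K L : Type*} [Field K] [LieRing L] [LieAlgebra K L] {r : ℕ} {x : Fin r → L}
  {φ : L →ₗ⁅K⁆ TruncatedTensor K r}

/-- Modulo `γ₂`, an element is the combination of the generators given by its coefficients in
degree one. -/
theorem sub_sum_coeff₁_mem (hx : LieSubalgebra.lieSpan K L (Set.range x) = ⊤)
    (hφ : ∀ i, φ (x i) = single i) (u : L) :
    u - ∑ k, coeff₁ (φ u) k • x k ∈ lowerCentralSeries K L L 1 := by
  have hu : u ∈ LieSubalgebra.lieSpan K L (Set.range x) := hx ▸ LieSubalgebra.mem_top u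
  induction hu using LieSubalgebra.lieSpan_induction with
  | mem u hu =>
    obtain ⟨i, rfl⟩ := hu
    simp [hφ]
  | zero => simp
  | add u v _ _ hu hv =>
    convert add_mem hu hv using 1
    simp [add_smul, Finset.sum_add_distrib]
    abel
  | smul t u _ hu =>
    convert (lowerCentralSeries K L L 1).smul_mem t hu using 1
    simp [smul_sub, Finset.smul_sum, smul_smul]
  | lie u v _ _ _ _ =>
    simp only [LieHom.map_lie, coeff₁_lie, zero_smul, Finset.sum_const_zero, sub_zero]
    rw [LieModule.lowerCentralSeries_succ]
    exact LieSubmodule.lie_mem_lie (LieSubmodule.mem_top u) (by simp)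

/-- Induction on `γ₂`, which is spanned by brackets. -/
theorem lowerCentralSeries_one_induction {p : (g : L) → g ∈ lowerCentralSeries K L L 1 → Prop}
    (lie : ∀ (u v : L) h, p ⁅u, v⁆ h) (zero : p 0 (zero_mem _))
    (add : ∀ u v hu hv, p u hu → p v hv → p (u + v) (add_mem hu hv))
    (smul : ∀ (t : K) u hu, p u hu → p (t • u) ((lowerCentralSeries K L L 1).smul_mem t hu))
    {g : L} (hg : g ∈ lowerCentralSeries K L L 1) : p g hg := by
  have hspan : (lowerCentralSeries K L L 1).toSubmodule =
      Submodule.span K {w | ∃ u v : L, ⁅u, v⁆ = w} := by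
    rw [LieModule.lowerCentralSeries_succ, LieSubmodule.lieIdeal_oper_eq_linear_span']
    simp
  have hmem (w : L) : w ∈ Submodule.span K {w | ∃ u v : L, ⁅u, v⁆ = w} ↔
      w ∈ lowerCentralSeries K L L 1 := by
    rw [← hspan, LieSubmodule.mem_toSubmodule]
  suffices ∃ h, p g h from this.2
  replace hg := (hmem g).2 hg
  induction hg using Submodule.span_induction with
  | mem w h =>
    obtain ⟨u, v, rfl⟩ := h
    exact ⟨(hmem _).1 (Submodule.subset_span ⟨u, v, rfl⟩), lie u v _⟩
  | zero => exact ⟨zero_mem _, zero⟩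
  | add u v _ _ hu hv => exact ⟨_, add u v hu.1 hv.1 hu.2 hv.2⟩
  | smul t u _ hu => exact ⟨_, smul t u hu.1 hu.2⟩

theorem coeff₁_eq_zero_of_mem (φ : L →ₗ⁅K⁆ TruncatedTensor K r) {g : L}
    (hg : g ∈ lowerCentralSeries K L L 1) (p : Fin r) : coeff₁ (φ g) p = 0 := by
  induction hg using lowerCentralSeries_one_induction with
  | lie u v _ => simp
  | zero => simp
  | add u v _ _ hu hv => simp [hu, hv]
  | smul t u _ hu => simp [hu]

theorem coeff₂_self_of_mem (φ : L →ₗ⁅K⁆ TruncatedTensor K r) {g : L}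
    (hg : g ∈ lowerCentralSeries K L L 1) (p : Fin r) : coeff₂ (φ g) p p = 0 := by
  induction hg using lowerCentralSeries_one_induction with
  | lie u v _ => simp [mul_comm]
  | zero => simp
  | add u v _ _ hu hv => simp [hu, hv]
  | smul t u _ hu => simp [hu]

theorem coeff₂_swap_of_mem (φ : L →ₗ⁅K⁆ TruncatedTensor K r) {g : L}
    (hg : g ∈ lowerCentralSeries K L L 1) (p q : Fin r) :
    coeff₂ (φ g) q p = -coeff₂ (φ g) p q := by
  induction hg using lowerCentralSeries_one_induction with
  | lie u v _ => simp; ring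
  | zero => simp
  | add u v _ _ hu hv => simp [hu, hv]; ring
  | smul t u _ hu => simp [hu]

/-- A bracket of two combinations of the `xₖ`, written in terms of the `[xₖ, xₗ]` with `k < l`. -/
theorem lie_sum_smul_eq_sum_lt (x : Fin r → L) (a b : Fin r → K) :
    ⁅∑ k, a k • x k, ∑ l, b l • x l⁆ =
      ∑ k, ∑ l, if k < l then (a k * b l - b k * a l) • ⁅x k, x l⁆ else 0 := by
  have h (k l : Fin r) : (a k * b l) • ⁅x k, x l⁆ =
      (if k < l then (a k * b l) • ⁅x k, x l⁆ else 0) +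
        (if l < k then (a k * b l) • ⁅x k, x l⁆ else 0) := by
    rcases lt_trichotomy k l with h | rfl | h
    · simp [h, h.not_gt]
    · simp
    · simp [h, h.not_gt]
  have h₁ : ⁅∑ k, a k • x k, ∑ l, b l • x l⁆ = ∑ k, ∑ l, (a k * b l) • ⁅x k, x l⁆ := by
    simp_rw [sum_lie, lie_sum, smul_lie, lie_smul, smul_smul]
  rw [h₁]
  rw [Finset.sum_congr rfl fun k _ => Finset.sum_congr rfl fun l _ => h k l]
  simp_rw [Finset.sum_add_distrib]
  rw [Finset.sum_comm (f := fun k l => if l < k then (a k * b l) • ⁅x k, x l⁆ else 0)]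
  simp_rw [← Finset.sum_add_distrib]
  refine Finset.sum_congr rfl fun k _ => Finset.sum_congr rfl fun l _ => ?_
  split_ifs
  · rw [sub_smul, sub_eq_add_neg, ← smul_neg, lie_skew, mul_comm (b k)]
  · simp

/-- Modulo `γ₃`, an element of `γ₂` is a combination of brackets of generators whose coefficients
are read off in degree two. -/
theorem sub_sum_coeff₂_mem (hx : LieSubalgebra.lieSpan K L (Set.range x) = ⊤)
    (hφ : ∀ i, φ (x i) = single i) {g : L} (hg : g ∈ lowerCentralSeries K L L 1) :
    g - ∑ k, ∑ l, (if k < l then coeff₂ (φ g) k l • ⁅x k, x l⁆ else 0) ∈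
      lowerCentralSeries K L L 2 := by
  induction hg using lowerCentralSeries_one_induction with
  | lie u v _ =>
    set u' := ∑ k, coeff₁ (φ u) k • x k with hu'
    set v' := ∑ k, coeff₁ (φ v) k • x k with hv'
    have hu : u - u' ∈ lowerCentralSeries K L L 1 := sub_sum_coeff₁_mem hx hφ u
    have hv : v - v' ∈ lowerCentralSeries K L L 1 := sub_sum_coeff₁_mem hx hφ v
    have h : ⁅u, v⁆ - ⁅u', v'⁆ = ⁅u, v - v'⁆ - ⁅v', u - u'⁆ := by
      rw [lie_sub, lie_sub, ← lie_skew u v', ← lie_skew u' v']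
      abel
    simp only [LieHom.map_lie, coeff₂_lie]
    rw [← lie_sum_smul_eq_sum_lt, ← hu', ← hv', h, LieModule.lowerCentralSeries_succ]
    exact sub_mem (LieSubmodule.lie_mem_lie (LieSubmodule.mem_top u) hv)
      (LieSubmodule.lie_mem_lie (LieSubmodule.mem_top v') hu)
  | zero => simp
  | add u v _ _ hu hv =>
    convert add_mem hu hv using 1
    rw [sub_add_sub_comm, ← Finset.sum_add_distrib]
    simp_rw [← Finset.sum_add_distrib, ← ite_add_zero, ← add_smul]
    simp
  | smul t u _ hu =>
    convert (lowerCentralSeries K L L 2).smul_mem t hu using 1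
    simp [smul_sub, Finset.smul_sum, smul_smul]

/-- If `[a, xᵢ] + [b, xⱼ] = 0` with `a, b ∈ γ₂` and `i ≠ j`, then `a` is central. Indeed `a`
vanishes in degree two: the tensors of `a` and `b` are alternating there, and comparing the coefficients in
degree three of `a xᵢ - xᵢ a + b xⱼ - xⱼ b` shows that `a` is zero on every word of length two. -/
theorem lie_eq_zero_of_lie_add_lie_eq_zero (hx : LieSubalgebra.lieSpan K L (Set.range x) = ⊤)
    (hL : lowerCentralSeries K L L 3 = ⊥) (hφ : ∀ i, φ (x i) = single i) {a b : L}
    (ha : a ∈ lowerCentralSeries K L L 1) (hb : b ∈ lowerCentralSeries K L L 1)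
    {i j : Fin r} (hij : i ≠ j) (h : ⁅a, x i⁆ + ⁅b, x j⁆ = 0) (u : L) : ⁅a, u⁆ = 0 := by
  have key (p q s : Fin r) := congrArg (fun w => coeff₃ (φ w) p q s) h
  simp only [map_add, LieHom.map_lie, hφ, Pi.add_apply, coeff₃_lie, coeff₁_single, coeff₂_single,
    coeff₁_eq_zero_of_mem φ ha, coeff₁_eq_zero_of_mem φ hb, map_zero, Pi.zero_apply,
    mul_zero, zero_add, add_zero] at key
  -- On a word `p q` with `p ∉ {i, j}` the coefficient of `p q i` in the relation is that of `a`.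
  have hout (p q : Fin r) (hpi : p ≠ i) (hpj : p ≠ j) : coeff₂ (φ a) p q = 0 := by
    simpa [hpi, hpj, hij] using key p q i
  -- On the word `i i j`, since `b` has no coefficient on `i i`.
  have hin : coeff₂ (φ a) i j = 0 := by
    simpa [hij, hij.symm, coeff₂_self_of_mem φ hb] using key i i j
  have hzero (p q : Fin r) : coeff₂ (φ a) p q = 0 := by
    by_cases hp : p ≠ i ∧ p ≠ j
    · exact hout p q hp.1 hp.2
    by_cases hq : q ≠ i ∧ q ≠ j
    · rw [coeff₂_swap_of_mem φ ha q p, hout q p hq.1 hq.2, neg_zero]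
    have hp' : p = i ∨ p = j := by tauto
    have hq' : q = i ∨ q = j := by tauto
    rcases hp' with rfl | rfl <;> rcases hq' with rfl | rfl
    · exact coeff₂_self_of_mem φ ha _
    · exact hin
    · rw [coeff₂_swap_of_mem φ ha, hin, neg_zero]
    · exact coeff₂_self_of_mem φ ha _
  have h₂ : a ∈ lowerCentralSeries K L L 2 := by
    simpa [hzero] using sub_sum_coeff₂_mem hx hφ ha
  have h₃ : ⁅u, a⁆ ∈ lowerCentralSeries K L L 3 := by
    rw [LieModule.lowerCentralSeries_succ]
    exact LieSubmodule.lie_mem_lie (LieSubmodule.mem_top u) h₂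
  rw [hL, LieSubmodule.mem_bot] at h₃
  rw [← lie_skew, h₃, neg_zero]

end Detection

/-! ### Almost inner derivations -/

section AlmostInner

open LieModule TruncatedTensor

variable {K L : Type*} [Field K] [LieRing L] [LieAlgebra K L] {r : ℕ} {x : Fin r → L}
  {φ : L →ₗ⁅K⁆ TruncatedTensor K r}

theorem innerDerivations_le_almostInnerDerivations (K L : Type*) [Field K] [LieRing L]
    [LieAlgebra K L] : innerDerivations K L ≤ almostInnerDerivations K L := by
  rintro _ ⟨y, rfl⟩
  exact fun u => ⟨y, LieDerivation.ad_apply_apply K L y u⟩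

/-- An almost inner derivation agrees on all generators, modulo `γ₃`, with a single inner
derivation. The coefficient of `xₖ` in an element `yᵢ` with `D xᵢ = [yᵢ, xᵢ]` is independent of
`i ≠ k`, since `D (xᵢ + xⱼ)` is a bracket with `xᵢ + xⱼ`. -/
theorem exists_forall_apply_eq_lie_of_almostInner
    (hx : LieSubalgebra.lieSpan K L (Set.range x) = ⊤) (hφ : ∀ i, φ (x i) = single i)
    {D : LieDerivation K L L} (hD : D ∈ almostInnerDerivations K L) :
    ∃ y : L, ∀ i, ∃ g ∈ lowerCentralSeries K L L 1, D (x i) = ⁅y + g, x i⁆ := by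
  choose z hz using hD
  have hc (i j k : Fin r) (hki : k ≠ i) (hkj : k ≠ j) :
      coeff₁ (φ (z (x i))) k = coeff₁ (φ (z (x j))) k := by
    rcases eq_or_ne i j with rfl | hij
    · rfl
    have key (p q : Fin r) := congrArg (fun w => coeff₂ (φ w) p q)
      ((hz (x i + x j)).symm.trans ((map_add D _ _).trans (congrArg₂ (· + ·) (hz _) (hz _))))
    simp only [map_add, LieHom.map_lie, hφ, Pi.add_apply, coeff₂_lie, coeff₁_single] at key
    have hi := key k i
    have hj := key k j
    simp only [hki, hkj, hij, hij.symm, if_true, if_false, mul_zero, mul_one, zero_mul, sub_zero,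
      add_zero, zero_add] at hi hj
    rw [← hi, ← hj]
  have hc' (k : Fin r) : ∃ c : K, ∀ i, k ≠ i → coeff₁ (φ (z (x i))) k = c := by
    by_cases h : ∃ j, k ≠ j
    · obtain ⟨j, hj⟩ := h
      exact ⟨_, fun i hi => hc i j k hi hj⟩
    · exact ⟨0, fun i hi => (h ⟨i, hi⟩).elim⟩
  choose c hc' using hc'
  refine ⟨∑ k, c k • x k, fun i => ⟨_, sub_sum_coeff₁_mem hx hφ (z (x i)), ?_⟩⟩
  have hsum : ∑ k, c k • x k - ∑ k, coeff₁ (φ (z (x i))) k • x k =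
      (c i - coeff₁ (φ (z (x i))) i) • x i := by
    rw [← Finset.sum_sub_distrib, Finset.sum_eq_single i]
    · rw [sub_smul]
    · intro k _ hk
      rw [hc' k i hk, sub_self]
    · simp
  rw [hz, add_sub_left_comm, hsum, add_lie, smul_lie, lie_self, smul_zero, add_zero]

/-- If an almost inner derivation maps each generator `xᵢ` to `[gᵢ, xᵢ]` with `gᵢ ∈ γ₂`, then the
differences `gᵢ - gⱼ` are central. -/
theorem lie_eq_lie_of_almostInner (hx : LieSubalgebra.lieSpan K L (Set.range x) = ⊤)
    (hL : lowerCentralSeries K L L 3 = ⊥) (hφ : ∀ i, φ (x i) = single i)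
    {D : LieDerivation K L L} (hD : D ∈ almostInnerDerivations K L) {g : Fin r → L}
    (hg : ∀ i, g i ∈ lowerCentralSeries K L L 1) (hDg : ∀ i, D (x i) = ⁅g i, x i⁆)
    (i j : Fin r) (u : L) : ⁅g i, u⁆ = ⁅g j, u⁆ := by
  rcases eq_or_ne i j with rfl | hij
  · rfl
  obtain ⟨z, hz⟩ := hD (x i + x j)
  rw [map_add, hDg, hDg] at hz
  -- In degree two, `z ∧ (xᵢ + xⱼ) = 0`, so that `z` is a multiple of `xᵢ + xⱼ` modulo `γ₂`.
  have key (p q : Fin r) := congrArg (fun w => coeff₂ (φ w) p q) hz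
  simp only [map_add, LieHom.map_lie, hφ, Pi.add_apply, coeff₂_lie, coeff₁_single,
    coeff₁_eq_zero_of_mem φ (hg i), coeff₁_eq_zero_of_mem φ (hg j), mul_zero, zero_mul,
    sub_zero, add_zero] at key
  have hout (k : Fin r) (hki : k ≠ i) (hkj : k ≠ j) : coeff₁ (φ z) k = 0 := by
    simpa [hki, hkj, hij] using (key k i).symm
  have hin : coeff₁ (φ z) i = coeff₁ (φ z) j := by
    simpa [hij, hij.symm, sub_eq_zero] using (key i j).symm
  have hsum : ∑ k, coeff₁ (φ z) k • x k = coeff₁ (φ z) i • (x i + x j) := by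
    rw [Fintype.sum_eq_add i j hij, smul_add, hin]
    rintro k ⟨hki, hkj⟩
    rw [hout k hki hkj, zero_smul]
  have hh := sub_sum_coeff₁_mem hx hφ z
  set h := z - ∑ k, coeff₁ (φ z) k • x k with hdef
  have hzh : ⁅z, x i + x j⁆ = ⁅h, x i + x j⁆ := by
    rw [hdef, hsum, sub_lie, smul_lie, lie_self, smul_zero, sub_zero]
  have hrel : ⁅g i - h, x i⁆ + ⁅g j - h, x j⁆ = 0 := by
    rw [sub_lie (g i) h, sub_lie (g j) h, sub_add_sub_comm, hz, hzh, lie_add, sub_self]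
  have hi := lie_eq_zero_of_lie_add_lie_eq_zero hx hL hφ (sub_mem (hg i) hh) (sub_mem (hg j) hh)
    hij hrel u
  have hj := lie_eq_zero_of_lie_add_lie_eq_zero hx hL hφ (sub_mem (hg j) hh) (sub_mem (hg i) hh)
    hij.symm ((add_comm _ _).trans hrel) u
  rw [sub_lie, sub_eq_zero] at hi hj
  rw [hi, hj]

theorem almostInnerDerivations_le_innerDerivations
    (hx : LieSubalgebra.lieSpan K L (Set.range x) = ⊤)
    (hL : lowerCentralSeries K L L 3 = ⊥) (hφ : ∀ i, φ (x i) = single i) :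
    almostInnerDerivations K L ≤ innerDerivations K L := by
  intro D hD
  obtain ⟨y, hy⟩ := exists_forall_apply_eq_lie_of_almostInner hx hφ hD
  choose g hg hDg using hy
  have hD' : D - LieDerivation.ad K L y ∈ almostInnerDerivations K L :=
    sub_mem hD (innerDerivations_le_almostInnerDerivations K L ⟨y, rfl⟩)
  have hg' (i j : Fin r) := lie_eq_lie_of_almostInner hx hL hφ hD' hg
    (fun i => by simp [hDg]) i j
  obtain ⟨w, hw⟩ : ∃ w : L, ∀ i, ⁅g i, x i⁆ = ⁅w, x i⁆ := by
    cases isEmpty_or_nonempty (Fin r) with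
    | inl _ => exact ⟨0, fun i => isEmptyElim i⟩
    | inr h => exact ⟨g h.some, fun i => hg' i _ _⟩
  refine ⟨y + w, LieDerivation.ext_of_lieSpan_eq_top _ hx ?_⟩
  rintro _ ⟨i, rfl⟩
  simp [hDg, hw]

end AlmostInner

/-! ### The free three-step nilpotent Lie algebra -/

section FreeNilpotent

open LieModule

variable (K : Type*) [Field K] (r : ℕ)

namespace FreeNilpotentLieAlgebra

/-- The `i`-th generator of the free `c`-step nilpotent Lie algebra. -/
noncomputable def of (c : ℕ) (i : Fin r) : FreeNilpotentLieAlgebra K r c :=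
  LieSubmodule.Quotient.mk (FreeLieAlgebra.of K i)

theorem lieSpan_range_of (c : ℕ) : LieSubalgebra.lieSpan K _ (Set.range (of K r c)) = ⊤ := by
  set S := LieSubalgebra.lieSpan K (FreeNilpotentLieAlgebra K r c) (Set.range (of K r c))
  let π : FreeLieAlgebra K (Fin r) →ₗ⁅K⁆ FreeNilpotentLieAlgebra K r c :=
    { (LieSubmodule.Quotient.mk' (lowerCentralSeries K (FreeLieAlgebra K (Fin r))
        (FreeLieAlgebra K (Fin r)) c) : _ →ₗ[K] _) with
      map_lie' := rfl }
  let σ : FreeLieAlgebra K (Fin r) →ₗ⁅K⁆ S :=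
    FreeLieAlgebra.lift K fun i => ⟨of K r c i, LieSubalgebra.subset_lieSpan ⟨i, rfl⟩⟩
  have h : S.incl.comp σ = π := FreeLieAlgebra.hom_ext fun i => by
    simp [σ]; rfl
  rw [eq_top_iff]
  rintro u -
  obtain ⟨v, rfl⟩ := LieSubmodule.Quotient.surjective_mk' _ u
  exact (LieHom.congr_fun h v) ▸ (σ v).2

theorem lowerCentralSeries_eq_bot (c : ℕ) : lowerCentralSeries K (FreeNilpotentLieAlgebra K r c)
    (FreeNilpotentLieAlgebra K r c) c = ⊥ := by
  rw [← LieSubmodule.toSubmodule_inj, ← coe_lowerCentralSeries_ideal_quot_eq,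
    ← map_lowerCentralSeries_eq c (LieSubmodule.Quotient.surjective_mk' _),
    (LieSubmodule.Quotient.map_mk'_eq_bot_le _ _).2 le_rfl]
  rfl

/-- The homomorphism to the truncated tensor algebra sending the `i`-th generator to the `i`-th
basis vector. It exists because the truncated tensor algebra satisfies `γ₄ = 0`. -/
noncomputable def toTruncatedTensor : FreeNilpotentLieAlgebra K r 3 →ₗ⁅K⁆ TruncatedTensor K r :=
  let φ : FreeLieAlgebra K (Fin r) →ₗ⁅K⁆ TruncatedTensor K r :=
    FreeLieAlgebra.lift K TruncatedTensor.single
  { Submodule.liftQ _ φ.toLinearMap fun u hu => by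
      have h : φ u ∈ lowerCentralSeries K (TruncatedTensor K r) (TruncatedTensor K r) 3 :=
        lieModule_lcs_map_le (f := φ) (g := φ.toLinearMap)
          (fun a b => (LieHom.map_lie φ a b).symm) 3 ⟨u, hu, rfl⟩
      rwa [TruncatedTensor.lowerCentralSeries_three_eq_bot, LieSubmodule.mem_bot] at h with
    map_lie' := by
      rintro ⟨u⟩ ⟨v⟩
      exact φ.map_lie u v }

theorem toTruncatedTensor_of (i : Fin r) :
    toTruncatedTensor K r (of K r 3 i) = TruncatedTensor.single i :=
  FreeLieAlgebra.lift_of_apply _ i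

end FreeNilpotentLieAlgebra

end FreeNilpotent

theorem theorem5p2 (K : Type*) [Field K] (r : ℕ) :
    almostInnerDerivations K (FreeNilpotentLieAlgebra K r 3) =
      innerDerivations K (FreeNilpotentLieAlgebra K r 3) :=
  le_antisymm
    (almostInnerDerivations_le_innerDerivations (FreeNilpotentLieAlgebra.lieSpan_range_of K r 3)
      (FreeNilpotentLieAlgebra.lowerCentralSeries_eq_bot K r 3)
      (FreeNilpotentLieAlgebra.toTruncatedTensor_of K r))
    (innerDerivations_le_almostInnerDerivations K _)
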